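/- Let $X$ be a complex Banach space, let $\phi:\mathbb N_0\to(0,\infty)$ be a sequence such that $\phi(n)\le C a^n$ for all $n\in\mathbb N_0$, with some constants $C>0$ and $a>0$, and let $f:\mathbb N_0\to X$. Let $\ell^1_\phi$ be the space of complex sequences $g$ with norm $\|g\|_{1,\phi}:=\sum_{n\ge 0}\phi(n)|g(n)|<\infty$. For $\lambda>a$ put $p_\lambda(n):=\lambda^{-(n+1)}$, so that $p_\lambda\in\ell^1_\phi$, and let $\tilde f(\lambda):=\sum_{n=0}^\infty f(n)\lambda^{-n}$ be the $Z$-transform of $f$, defined where the series converges in $X$. For $\omega=\log a$, let $C^\infty_W((\omega,\infty),X;\phi)$ be the Widder space of all infinitely differentiable (in norm) functions $r:(\omega,\infty)\to X$ such that $$\sup\left\{\frac{\|r^{(k)}(\mu)\|}{\|\beta_{k,\mu}\|_{1,\phi}}\ :\ k\in\mathbb N_0,\ \mu>\omega\right\}<\infty,\qquad \beta_{k,\mu}(n):=n^k e^{-\mu n}\quad(0^0:=1).$$ Then the following assertions are equivalent. (i) $\displaystyle\sup_{n\in\mathbb N_0}\frac{\|f(n)\|}{\phi(n)}<\infty$.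 (ii) There is a bounded linear map $\theta:\ell^1_\phi\to X$ such that, for every real $\lambda>a$, the series $\tilde f(\lambda)$ converges and $\theta(\lambda p_\lambda)=\tilde f(\lambda)$. (iii) The series $\tilde f(\lambda)$ converges for every real $\lambda>a$, and $\tilde f\circ\exp\in C^\infty_W((\log a,\infty),X;\phi)$. -/

import Mathlib

open Filter Topology Set
open scoped ContDiff

namespace ZWidder

/-- The sequences `g : ℕ → ℂ` with `∑ φ(n) |g(n)| < ∞`, for a weight `φ : ℕ → (0, ∞)`,
as a linear subspace of the space of all sequences. -/
def weightedL1Submodule (φ : ℕ → Ioi (0 : ℝ)) : Submodule ℂ (ℕ → ℂ) where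
  carrier := {g | Summable fun n => (φ n : ℝ) * ‖g n‖}
  zero_mem' := by simp [summable_zero]
  add_mem' := by
    intro g h hg hh
    refine Summable.of_nonneg_of_le (fun n => ?_) (fun n => ?_) (hg.add hh)
    · exact mul_nonneg (le_of_lt (φ n).2) (norm_nonneg _)
    · rw [← mul_add]
      exact mul_le_mul_of_nonneg_left (norm_add_le _ _) (le_of_lt (φ n).2)
  smul_mem' := by
    intro c g hg
    refine (Summable.mul_left ‖c‖ hg).congr fun n => ?_
    simp only [Pi.smul_apply, norm_smul]
    ring

/-- The weighted sum `‖g‖_{1,φ} = ∑ φ(n) |g(n)|` of a complex sequence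
(only used for `g` in `ℓ¹_φ`). -/
noncomputable def weightedNorm (φ : ℕ → Ioi (0 : ℝ)) (g : ℕ → ℂ) : ℝ :=
  ∑' n, (φ n : ℝ) * ‖g n‖

/-- The space `ℓ¹_φ`, normed below by `‖·‖_{1,φ}`. It is a type synonym of the subspace above,
so that it does not inherit the topology of pointwise convergence. -/
def WeightedL1 (φ : ℕ → Ioi (0 : ℝ)) : Type := weightedL1Submodule φ

noncomputable instance WeightedL1.instAddCommGroup (φ : ℕ → Ioi (0 : ℝ)) :
    AddCommGroup (WeightedL1 φ) :=
  inferInstanceAs (AddCommGroup (weightedL1Submodule φ))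

noncomputable instance WeightedL1.instModule (φ : ℕ → Ioi (0 : ℝ)) :
    Module ℂ (WeightedL1 φ) :=
  inferInstanceAs (Module ℂ (weightedL1Submodule φ))

noncomputable instance WeightedL1.instNorm (φ : ℕ → Ioi (0 : ℝ)) : Norm (WeightedL1 φ) :=
  ⟨fun g => weightedNorm φ g.1⟩

theorem WeightedL1.normedSpaceCore (φ : ℕ → Ioi (0 : ℝ)) :
    NormedSpace.Core ℂ (WeightedL1 φ) where
  norm_nonneg g := tsum_nonneg fun n => mul_nonneg (le_of_lt (φ n).2) (norm_nonneg _)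
  norm_smul c g := by
    change ∑' n, (φ n : ℝ) * ‖c • g.1 n‖ = ‖c‖ * ∑' n, (φ n : ℝ) * ‖g.1 n‖
    rw [← tsum_mul_left]
    refine tsum_congr fun n => ?_
    rw [norm_smul]
    ring
  norm_triangle g h := by
    change ∑' n, (φ n : ℝ) * ‖g.1 n + h.1 n‖ ≤
      (∑' n, (φ n : ℝ) * ‖g.1 n‖) + ∑' n, (φ n : ℝ) * ‖h.1 n‖
    rw [← Summable.tsum_add g.2 h.2]
    refine Summable.tsum_le_tsum (fun n => ?_) (g + h).2 (g.2.add h.2)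
    rw [← mul_add]
    exact mul_le_mul_of_nonneg_left (norm_add_le _ _) (le_of_lt (φ n).2)
  norm_eq_zero_iff g := by
    change ∑' n, (φ n : ℝ) * ‖g.1 n‖ = 0 ↔ g = 0
    have h0 : ∀ n, 0 ≤ (φ n : ℝ) * ‖g.1 n‖ :=
      fun n => mul_nonneg (le_of_lt (φ n).2) (norm_nonneg _)
    constructor
    · intro h
      have h1 := (hasSum_zero_iff_of_nonneg h0).1 (h ▸ Summable.hasSum g.2)
      refine Subtype.ext (funext fun n => ?_)
      have h2 : (φ n : ℝ) * ‖g.1 n‖ = 0 := congrFun h1 n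
      have h3 : (0 : ℝ) < φ n := (φ n).2
      exact norm_eq_zero.1 ((mul_eq_zero.1 h2).resolve_left h3.ne')
    · rintro rfl
      have h1 : ∀ n, (φ n : ℝ) * ‖(0 : WeightedL1 φ).1 n‖ = 0 := fun n => by
        change (φ n : ℝ) * ‖(0 : ℂ)‖ = 0
        simp
      simp only [h1, tsum_zero]

noncomputable instance WeightedL1.instNormedAddCommGroup (φ : ℕ → Ioi (0 : ℝ)) :
    NormedAddCommGroup (WeightedL1 φ) :=
  NormedAddCommGroup.ofCore (WeightedL1.normedSpaceCore φ)

noncomputable instance WeightedL1.instNormedSpace (φ : ℕ → Ioi (0 : ℝ)) :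
    NormedSpace ℂ (WeightedL1 φ) :=
  NormedSpace.ofCore (WeightedL1.normedSpaceCore φ)

/-- The sequence `p_z(n) = z^{-(n+1)}`. -/
noncomputable def pSeq (z : ℂ) (n : ℕ) : ℂ := z ^ (-((n : ℤ) + 1))

theorem pSeq_mem {φ : ℕ → Ioi (0 : ℝ)} {C a : ℝ} (ha : 0 < a)
    (hφ : ∀ n, (φ n : ℝ) ≤ C * a ^ n) {z : ℂ} (hz : a < ‖z‖) :
    pSeq z ∈ weightedL1Submodule φ := by
  have hz0 : 0 < ‖z‖ := ha.trans hz
  have hs : Summable fun n : ℕ => C * ‖z‖⁻¹ * (a / ‖z‖) ^ n :=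
    (summable_geometric_of_lt_one (by positivity) ((div_lt_one hz0).2 hz)).mul_left _
  refine Summable.of_nonneg_of_le
    (fun n => mul_nonneg (le_of_lt (φ n).2) (norm_nonneg _)) (fun n => ?_) hs
  have h1 : ‖pSeq z n‖ = (‖z‖ ^ (n + 1))⁻¹ := by
    rw [pSeq, norm_zpow, zpow_neg]
    norm_cast
  rw [h1]
  calc (φ n : ℝ) * (‖z‖ ^ (n + 1))⁻¹ ≤ C * a ^ n * (‖z‖ ^ (n + 1))⁻¹ :=
        mul_le_mul_of_nonneg_right (hφ n) (by positivity)
    _ = C * ‖z‖⁻¹ * (a / ‖z‖) ^ n := by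
        rw [div_pow, pow_succ]
        field_simp

/-- The sequence `p_x`, for real `x > a`, as an element of `ℓ¹_φ`. -/
noncomputable def pElem {φ : ℕ → Ioi (0 : ℝ)} {C a : ℝ} (ha : 0 < a)
    (hφ : ∀ n, (φ n : ℝ) ≤ C * a ^ n) {x : ℝ} (hx : a < x) : WeightedL1 φ :=
  ⟨pSeq (x : ℂ), pSeq_mem ha hφ
    (by rwa [Complex.norm_real, Real.norm_of_nonneg (ha.trans hx).le])⟩

section Transform

variable {X : Type*} [NormedAddCommGroup X] [NormedSpace ℂ X]

/-- Partial sums of the series `∑ f(n) z^{-n}`. -/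
noncomputable def zPartialSum (f : ℕ → X) (z : ℂ) (N : ℕ) : X :=
  ∑ n ∈ Finset.range N, z ^ (-(n : ℤ)) • f n

/-- `z` belongs to the region of convergence of the `Z`-transform of `f`. -/
def ZConvergesAt (f : ℕ → X) (z : ℂ) : Prop :=
  ∃ x : X, Tendsto (zPartialSum f z) atTop (𝓝 x)

/-- The `Z`-transform `∑ f(n) z^{-n}`; meaningful in the region of convergence. -/
noncomputable def zTransform (f : ℕ → X) (z : ℂ) : X :=
  limUnder atTop (zPartialSum f z)

/-- The sequence `β_{k,t}(n) = n^k e^{-t n}` (with `0^0 = 1`). -/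
noncomputable def betaSeq (k : ℕ) (t : ℝ) (n : ℕ) : ℂ :=
  (((n : ℝ) ^ k * Real.exp (-(t * n)) : ℝ) : ℂ)

/-- The Widder space `C^∞_W((b, ∞), X; φ)`: functions `r`, of which only the restriction to
`(b, ∞)` matters, that are infinitely differentiable on `(b, ∞)` and satisfy
`sup {‖r^{(k)}(t)‖ / ‖β_{k,t}‖_{1,φ} | k ∈ ℕ, t > b} < ∞`. -/
def WidderSpace (b : ℝ) (X : Type*) [NormedAddCommGroup X] [NormedSpace ℂ X]
    (φ : ℕ → Ioi (0 : ℝ)) : Set (ℝ → X) :=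
  {r | ContDiffOn ℝ ∞ r (Ioi b) ∧
    BddAbove {y : ℝ | ∃ (k : ℕ) (t : ℝ), b < t ∧
      y = ‖iteratedDerivWithin k r (Ioi b) t‖ / weightedNorm φ (betaSeq k t)}}

end Transform

end ZWidder

/-! With `λ = e^t` the transform becomes `∑ e^{-tn} f(n)`, with `k`-th derivative `∑ (-n)^k e^{-tn}
f(n)`, while `‖β_{k,t}‖` is the same series, up to sign, with `φ` in place of `f`. A bound `‖f‖ ≤
Mφ` thus gives the Widder estimate termwise. The converse is a discrete Post–Widder inversion: for
`m > 0` and `t = k/m` the kernel `n^k e^{-tn}` peaks exactly at `n = m`, and its normalisation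
concentrates there as `k → ∞`; for `m = 0`, order `0` and `t → ∞` do the same. In the limit the
estimate becomes `‖f(m)‖ ≤ Mφ(m)` (`norm_le_of_norm_expSeries_le`).

From (i), `θ(g) = ∑ g(n) f(n)` gives (ii). Conversely, expanding `λp_λ` in unit sequences `e_n`
shows that `f` and `n ↦ θ(e_n)` have the same transform. The inversion with `M = 0` gives
uniqueness, so `f(n) = θ(e_n)`, and `‖e_n‖ = φ(n)`. -/

namespace ZWidder

/-! ### Exponential series and their derivatives -/

section ExpSeries

variable {E : Type*} [NormedAddCommGroup E]

/-- `f` grows at most like `y ^ n` for every `y > a`. -/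
def HasGrowth (a : ℝ) (f : ℕ → E) : Prop :=
  ∀ y, a < y → ∃ K, ∀ n, ‖f n‖ ≤ K * y ^ n

theorem HasGrowth.summable {a : ℝ} (ha : 0 < a) {f : ℕ → E} (hf : HasGrowth a f) (k : ℕ)
    {t : ℝ} (ht : Real.log a < t) :
    Summable fun n : ℕ => (n : ℝ) ^ k * Real.exp (-(t * n)) * ‖f n‖ := by
  -- The gap `t - c` leaves an exponential decay that absorbs `n^k`.
  obtain ⟨c, hc, hct⟩ := exists_between ht
  obtain ⟨K, hK⟩ := hf (Real.exp c) ((Real.log_lt_iff_lt_exp ha).1 hc)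
  have hs := (Real.summable_pow_mul_exp_neg_nat_mul k (sub_pos.2 hct)).mul_left K
  refine Summable.of_nonneg_of_le (fun n => by positivity) (fun n => ?_) hs
  calc (n : ℝ) ^ k * Real.exp (-(t * n)) * ‖f n‖
      ≤ (n : ℝ) ^ k * Real.exp (-(t * n)) * (K * Real.exp c ^ n) := by
        gcongr; exact hK n
    _ = K * ((n : ℝ) ^ k * (Real.exp (-(t * n)) * Real.exp c ^ n)) := by ring
    _ = _ := by
        rw [← Real.exp_nat_mul, ← Real.exp_add]
        congr 3
        ring

variable [NormedSpace ℝ E]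

/-- The `k`-th derivative of `t ↦ ∑ e^{-t n} f(n)`, computed termwise. -/
noncomputable def expSeries (f : ℕ → E) (k : ℕ) (t : ℝ) : E :=
  ∑' n : ℕ, ((-(n : ℝ)) ^ k * Real.exp (-(t * n))) • f n

theorem norm_expSeries_term (f : ℕ → E) (k : ℕ) (t : ℝ) (n : ℕ) :
    ‖((-(n : ℝ)) ^ k * Real.exp (-(t * n))) • f n‖ =
      (n : ℝ) ^ k * Real.exp (-(t * n)) * ‖f n‖ := by
  simp [norm_smul]

theorem norm_expSeries_eq (f : ℕ → E) (k : ℕ) (t : ℝ) :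
    ‖expSeries f k t‖ = ‖∑' n : ℕ, ((n : ℝ) ^ k * Real.exp (-(t * n))) • f n‖ := by
  have h : expSeries f k t =
      ∑' n : ℕ, ((-1 : ℝ) ^ k) • (((n : ℝ) ^ k * Real.exp (-(t * n))) • f n) := by
    refine tsum_congr fun n => ?_
    rw [smul_smul, neg_pow, mul_assoc]
  rcases Nat.even_or_odd k with hk | hk
  · simp [h, hk.neg_one_pow]
  · simp [h, hk.neg_one_pow, tsum_neg]

theorem hasDerivAt_expSeries [CompleteSpace E] {a : ℝ} (ha : 0 < a) {f : ℕ → E}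
    (hf : HasGrowth a f) (k : ℕ) {t : ℝ} (ht : Real.log a < t) :
    HasDerivAt (expSeries f k) (expSeries f (k + 1) t) t := by
  -- The differentiated terms on `(c, ∞)` are dominated by their norms at `c`, uniformly in `s`.
  obtain ⟨c, hc, hct⟩ := exists_between ht
  refine hasDerivAt_tsum_of_isPreconnected
      (g := fun (n : ℕ) (s : ℝ) => ((-(n : ℝ)) ^ k * Real.exp (-(s * n))) • f n)
      (g' := fun (n : ℕ) (s : ℝ) => ((-(n : ℝ)) ^ (k + 1) * Real.exp (-(s * n))) • f n)
      (u := fun n : ℕ =>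
      (n : ℝ) ^ (k + 1) * Real.exp (-(c * n)) * ‖f n‖) (t := Ioi c) (y₀ := t)
    (hf.summable ha (k + 1) hc) isOpen_Ioi isPreconnected_Ioi (fun n s _ => ?_)
    (fun n s hs => ?_) hct ?_ hct
  · have h1 : HasDerivAt (fun s : ℝ => -(s * n)) (-(n : ℝ)) s := by
      have h0 := ((hasDerivAt_id' s).mul_const (n : ℝ)).neg
      rw [one_mul] at h0
      exact h0
    have h2 := (h1.exp.const_mul ((-(n : ℝ)) ^ k)).smul_const (f n)
    convert h2 using 2
    ring
  · rw [norm_expSeries_term]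
    have : c ≤ s := le_of_lt hs
    gcongr
  · refine Summable.of_norm ?_
    simpa only [norm_expSeries_term] using hf.summable ha k ht

theorem iteratedDerivWithin_expSeries [CompleteSpace E] {a : ℝ} (ha : 0 < a) {f : ℕ → E}
    (hf : HasGrowth a f) (k : ℕ) :
    EqOn (iteratedDerivWithin k (expSeries f 0) (Ioi (Real.log a))) (expSeries f k)
      (Ioi (Real.log a)) := by
  induction k with
  | zero => intro t _; simp
  | succ k ih =>
    intro t ht
    rw [iteratedDerivWithin_succ, derivWithin_congr ih (ih ht)]
    exact (hasDerivAt_expSeries ha hf k ht).hasDerivWithinAt.derivWithin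
      (isOpen_Ioi.uniqueDiffWithinAt ht)

theorem contDiffOn_expSeries [CompleteSpace E] {a : ℝ} (ha : 0 < a) {f : ℕ → E}
    (hf : HasGrowth a f) : ContDiffOn ℝ ∞ (expSeries f 0) (Ioi (Real.log a)) := by
  refine contDiffOn_of_differentiableOn_deriv fun k _ => ?_
  exact DifferentiableOn.congr
    (fun t ht => (hasDerivAt_expSeries ha hf k ht).differentiableAt.differentiableWithinAt)
    (iteratedDerivWithin_expSeries ha hf k)

/-! ### Post–Widder inversion -/

/-- If `0 ≤ q ≤ 1` and `q` equals `1` only at `m`, the powers of `q` isolate the `m`-th term. -/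
theorem tendsto_tsum_pow_smul [CompleteSpace E] {q : ℕ → ℝ} {m : ℕ} (hq0 : ∀ n, 0 ≤ q n)
    (hqm : q m = 1) (hq1 : ∀ n, n ≠ m → q n < 1) (f : ℕ → E) {K : ℕ}
    (hs : Summable fun n => q n ^ K * ‖f n‖) :
    Tendsto (fun k : ℕ => ∑' n, (q n ^ k) • f n) atTop (𝓝 (f m)) := by
  have hle : ∀ n, q n ≤ 1 := fun n => by
    rcases eq_or_ne n m with rfl | h
    · exact hqm.le
    · exact (hq1 n h).le
  have hlim : f m = ∑' n, if n = m then f m else 0 := by simp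
  rw [hlim]
  refine tendsto_tsum_of_dominated_convergence hs (fun n => ?_) ?_
  · rcases eq_or_ne n m with rfl | h
    · simp [hqm]
    · simpa [h] using (tendsto_pow_atTop_nhds_zero_of_lt_one (hq0 n) (hq1 n h)).smul_const (f n)
  · filter_upwards [eventually_ge_atTop K] with k hk n
    rw [norm_smul, norm_pow, Real.norm_of_nonneg (hq0 n)]
    exact mul_le_mul_of_nonneg_right (pow_le_pow_of_le_one (hq0 n) (hle n) hk) (norm_nonneg _)

/-- For `m > 0` take `q(n) = s e^{1-s}` with `s = n/m`, which attains its maximum `1` only at `s =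
1`; for `m = 0`, `e^{-n}` suffices. Large powers are needed only to push `t` beyond `b`. -/
theorem exists_isolating_kernel (b : ℝ) (m : ℕ) :
    ∃ q : ℕ → ℝ, (∀ n, 0 ≤ q n) ∧ q m = 1 ∧ (∀ n, n ≠ m → q n < 1) ∧
      ∃ K : ℕ, ∀ k ≥ K, ∃ (j : ℕ) (t c : ℝ), b < t ∧ 0 < c ∧
        ∀ n : ℕ, q n ^ k = c * ((n : ℝ) ^ j * Real.exp (-(t * n))) := by
  rcases Nat.eq_zero_or_pos m with rfl | hm
  · refine ⟨fun n => Real.exp (-n), fun n => (Real.exp_pos _).le, by simp, fun n hn => ?_, ?_⟩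
    · have : (0 : ℝ) < n := by exact_mod_cast Nat.pos_of_ne_zero hn
      simpa using hn.bot_lt
    · obtain ⟨K, hK⟩ := exists_nat_gt b
      refine ⟨K, fun k hk => ⟨0, k, 1, hK.trans_le (by exact_mod_cast hk), one_pos, fun n => ?_⟩⟩
      simp [← Real.exp_nat_mul]
  · have hm' : (0 : ℝ) < m := by exact_mod_cast hm
    refine ⟨fun n => n / m * Real.exp (1 - n / m), fun n => by positivity, ?_, fun n hn => ?_, ?_⟩
    · simp [hm'.ne']
    · have h1 : (n : ℝ) / m - 1 ≠ 0 := by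
        rw [sub_ne_zero, Ne, div_eq_one_iff_eq hm'.ne']
        exact_mod_cast hn
      -- Strictness of `1 + u < e^u` at `u = n/m - 1 ≠ 0` makes the peak unique.
      have h2 := Real.add_one_lt_exp h1
      have h3 : Real.exp (1 - (n : ℝ) / m) = (Real.exp ((n : ℝ) / m - 1))⁻¹ := by
        rw [← Real.exp_neg, neg_sub]
      beta_reduce
      rw [h3, ← div_eq_mul_inv, div_lt_one (Real.exp_pos _)]
      linarith
    · obtain ⟨K, hK⟩ := exists_nat_gt (b * m)
      refine ⟨K, fun k hk => ⟨k, k / m, Real.exp k / m ^ k, ?_, by positivity, fun n => ?_⟩⟩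
      · rw [lt_div_iff₀ hm']
        exact hK.trans_le (by exact_mod_cast hk)
      · have : Real.exp (-((k : ℝ) / m * n)) * Real.exp k = Real.exp (1 - (n : ℝ) / m) ^ k := by
          rw [← Real.exp_nat_mul, ← Real.exp_add]
          congr 1
          ring
        rw [mul_pow, ← this, div_pow]
        ring

/-- An inequality between all derivatives of two exponential series passes to coefficients. -/
theorem norm_le_of_norm_expSeries_le [CompleteSpace E] {a : ℝ} (ha : 0 < a) {f : ℕ → E}
    (hf : HasGrowth a f) {φ : ℕ → ℝ} (hφ : HasGrowth a φ) {M : ℝ}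
    (h : ∀ (k : ℕ) (t : ℝ), Real.log a < t →
      ‖expSeries f k t‖ ≤ M * ∑' n : ℕ, (n : ℝ) ^ k * Real.exp (-(t * n)) * φ n) (m : ℕ) :
    ‖f m‖ ≤ M * φ m := by
  obtain ⟨q, hq0, hqm, hq1, K, hK⟩ := exists_isolating_kernel (Real.log a) m
  -- The power `q^K` itself provides the dominating series for both limits.
  obtain ⟨i, s, d, hs, -, hqK⟩ := hK K le_rfl
  have hF := (tendsto_tsum_pow_smul hq0 hqm hq1 f (K := K)
    (by simpa only [hqK, mul_assoc] using (hf.summable ha i hs).mul_left d)).norm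
  have hΦ := (tendsto_tsum_pow_smul hq0 hqm hq1 φ (K := K)
    (by simpa only [hqK, mul_assoc] using (hφ.summable ha i hs).mul_left d)).const_mul M
  refine le_of_tendsto_of_tendsto hF hΦ ?_
  filter_upwards [eventually_ge_atTop K] with k hk
  obtain ⟨j, t, c, ht, hc, hqk⟩ := hK k hk
  have h1 := h j t ht
  rw [norm_expSeries_eq] at h1
  simp only [hqk, mul_smul c, tsum_const_smul'', norm_smul, Real.norm_of_nonneg hc.le]
  calc _ ≤ c * (M * ∑' n : ℕ, (n : ℝ) ^ j * Real.exp (-(t * n)) * φ n) := by gcongr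
    _ = _ := by simp only [smul_eq_mul]; ring

end ExpSeries

/-! ### Growth and norms for the weight -/

theorem hasGrowth_weight {φ : ℕ → Ioi (0 : ℝ)} {C a : ℝ} (hC : 0 < C) (ha : 0 < a)
    (hφ : ∀ n, (φ n : ℝ) ≤ C * a ^ n) : HasGrowth a fun n => (φ n : ℝ) := by
  refine fun y hy => ⟨C, fun n => ?_⟩
  rw [Real.norm_of_nonneg (le_of_lt (φ n).2)]
  exact (hφ n).trans (by gcongr)

theorem HasGrowth.of_norm_le {E : Type*} [NormedAddCommGroup E] {φ : ℕ → Ioi (0 : ℝ)} {a M : ℝ}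
    (hφ : HasGrowth a fun n => (φ n : ℝ)) {f : ℕ → E} (h : ∀ n, ‖f n‖ ≤ M * φ n) :
    HasGrowth a f := by
  intro y hy
  obtain ⟨K, hK⟩ := hφ y hy
  refine ⟨|M| * K, fun n => (h n).trans ?_⟩
  have h0 : (0 : ℝ) ≤ φ n := le_of_lt (φ n).2
  have h1 := hK n
  rw [Real.norm_of_nonneg h0] at h1
  rw [mul_assoc]
  exact mul_le_mul (le_abs_self M) h1 h0 (abs_nonneg M)

theorem weightedNorm_betaSeq (φ : ℕ → Ioi (0 : ℝ)) (k : ℕ) (t : ℝ) :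
    weightedNorm φ (betaSeq k t) = ∑' n : ℕ, (n : ℝ) ^ k * Real.exp (-(t * n)) * φ n := by
  refine tsum_congr fun n => ?_
  rw [betaSeq, Complex.norm_real, Real.norm_of_nonneg (by positivity), mul_comm]

theorem weightedNorm_betaSeq_pos {φ : ℕ → Ioi (0 : ℝ)} {a : ℝ} (ha : 0 < a)
    (hφ : HasGrowth a fun n => (φ n : ℝ)) (k : ℕ) {t : ℝ} (ht : Real.log a < t) :
    0 < weightedNorm φ (betaSeq k t) := by
  have h0 : ∀ n, (0 : ℝ) < φ n := fun n => (φ n).2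
  rw [weightedNorm_betaSeq]
  have hs := hφ.summable ha k ht
  simp only [Real.norm_of_nonneg (h0 _).le] at hs
  -- Index `1`, because the term at `0` vanishes when `k > 0`.
  refine hs.tsum_pos (fun n => mul_nonneg (by positivity) (h0 n).le) 1 ?_
  exact mul_pos (by positivity) (h0 1)

theorem bddAbove_range_norm_div_iff {X : Type*} [NormedAddCommGroup X] {φ : ℕ → Ioi (0 : ℝ)} {f : ℕ → X} :
    BddAbove (range fun n : ℕ => ‖f n‖ / (φ n : ℝ)) ↔ ∃ M, ∀ n, ‖f n‖ ≤ M * φ n := by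
  have h0 : ∀ n, (0 : ℝ) < φ n := fun n => (φ n).2
  simp only [BddAbove, Set.Nonempty, mem_upperBounds, forall_mem_range, div_le_iff₀ (h0 _)]

/-! ### The Z-transform and the Widder space -/

section Transform

variable {X : Type*} [NormedAddCommGroup X] [NormedSpace ℂ X]

theorem zpow_smul_eq_exp_smul (f : ℕ → X) (t : ℝ) (n : ℕ) :
    ((Real.exp t : ℝ) : ℂ) ^ (-(n : ℤ)) • f n =
      ((-(n : ℝ)) ^ 0 * Real.exp (-(t * n))) • f n := by
  have h : ((Real.exp t : ℝ) : ℂ) ^ (-(n : ℤ)) = ((Real.exp (-(t * n)) : ℝ) : ℂ) := by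
    rw [zpow_neg, zpow_natCast, Real.exp_neg, mul_comm, Real.exp_nat_mul]
    push_cast
    rfl
  rw [h, pow_zero, one_mul, Complex.coe_smul]

theorem hasSum_expSeries_zero [CompleteSpace X] {a : ℝ} (ha : 0 < a) {f : ℕ → X}
    (hf : HasGrowth a f) {t : ℝ} (ht : Real.log a < t) :
    HasSum (fun n : ℕ => ((Real.exp t : ℝ) : ℂ) ^ (-(n : ℤ)) • f n) (expSeries f 0 t) := by
  simp only [zpow_smul_eq_exp_smul]
  refine (Summable.of_norm ?_).hasSum
  simpa only [norm_expSeries_term] using hf.summable ha 0 ht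

theorem HasGrowth.zConvergesAt [CompleteSpace X] {a : ℝ} (ha : 0 < a) {f : ℕ → X}
    (hf : HasGrowth a f) {x : ℝ} (hx : a < x) : ZConvergesAt f (x : ℂ) := by
  have h := hasSum_expSeries_zero ha hf (Real.log_lt_log ha hx)
  rw [Real.exp_log (ha.trans hx)] at h
  exact ⟨_, h.tendsto_sum_nat⟩

theorem HasGrowth.zTransform_exp [CompleteSpace X] {a : ℝ} (ha : 0 < a) {f : ℕ → X}
    (hf : HasGrowth a f) {t : ℝ} (ht : Real.log a < t) :
    zTransform f ((Real.exp t : ℝ) : ℂ) = expSeries f 0 t :=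
  (hasSum_expSeries_zero ha hf ht).tendsto_sum_nat.limUnder_eq

/-- Convergent partial sums are bounded, hence so are their successive differences `y^{-n} f(n)`. -/
theorem hasGrowth_of_zConvergesAt {a : ℝ} (ha : 0 < a) {f : ℕ → X}
    (h : ∀ x : ℝ, a < x → ZConvergesAt f (x : ℂ)) : HasGrowth a f := by
  intro y hy
  have hy0 : 0 < y := ha.trans hy
  obtain ⟨s, hs⟩ := h y hy
  obtain ⟨B, hB⟩ := (hs.norm).bddAbove_range
  refine ⟨B + B, fun n => ?_⟩
  have h1 : zPartialSum f (y : ℂ) (n + 1) - zPartialSum f (y : ℂ) n = (y : ℂ) ^ (-(n : ℤ)) • f n := by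
    simp [zPartialSum, Finset.sum_range_succ]
  have h2 : ‖(y : ℂ) ^ (-(n : ℤ)) • f n‖ ≤ B + B := by
    rw [← h1]
    exact (norm_sub_le _ _).trans (add_le_add (hB ⟨n + 1, rfl⟩) (hB ⟨n, rfl⟩))
  rw [norm_smul, norm_zpow, Complex.norm_real, Real.norm_of_nonneg hy0.le, zpow_neg,
    zpow_natCast, inv_mul_le_iff₀ (by positivity)] at h2
  rwa [mul_comm]

theorem iteratedDerivWithin_zTransform_comp_exp [CompleteSpace X] {a : ℝ} (ha : 0 < a)
    {f : ℕ → X} (hf : HasGrowth a f) (k : ℕ) {t : ℝ} (ht : Real.log a < t) :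
    iteratedDerivWithin k ((fun x : ℝ => zTransform f (x : ℂ)) ∘ Real.exp)
      (Ioi (Real.log a)) t = expSeries f k t := by
  rw [← iteratedDerivWithin_expSeries ha hf k ht]
  exact iteratedDerivWithin_congr (fun s hs => hf.zTransform_exp ha hs) ht

theorem HasGrowth.comp_exp_mem_widderSpace [CompleteSpace X] {φ : ℕ → Ioi (0 : ℝ)} {a M : ℝ}
    (ha : 0 < a) (hφ : HasGrowth a fun n => (φ n : ℝ)) {f : ℕ → X}
    (h : ∀ n, ‖f n‖ ≤ M * φ n) :
    ((fun x : ℝ => zTransform f (x : ℂ)) ∘ Real.exp) ∈ WidderSpace (Real.log a) X φ := by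
  have hf : HasGrowth a f := hφ.of_norm_le h
  refine ⟨(contDiffOn_expSeries ha hf).congr fun t ht => hf.zTransform_exp ha ht, M, ?_⟩
  rintro _ ⟨k, t, ht, rfl⟩
  rw [iteratedDerivWithin_zTransform_comp_exp ha hf k ht,
    div_le_iff₀ (weightedNorm_betaSeq_pos ha hφ k ht), weightedNorm_betaSeq, ← tsum_mul_left]
  have hs := (hφ.summable ha k ht).mul_left M
  simp only [Real.norm_of_nonneg (le_of_lt (φ _).2)] at hs
  refine tsum_of_norm_bounded hs.hasSum fun n => ?_
  rw [norm_expSeries_term]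
  calc _ ≤ (n : ℝ) ^ k * Real.exp (-(t * n)) * (M * φ n) := by gcongr; exact h n
    _ = _ := by ring

theorem norm_le_of_mem_widderSpace [CompleteSpace X] {φ : ℕ → Ioi (0 : ℝ)} {a : ℝ}
    (ha : 0 < a) (hφ : HasGrowth a fun n => (φ n : ℝ)) {f : ℕ → X} (hf : HasGrowth a f)
    (h : ((fun x : ℝ => zTransform f (x : ℂ)) ∘ Real.exp) ∈ WidderSpace (Real.log a) X φ) :
    ∃ M, ∀ n, ‖f n‖ ≤ M * φ n := by
  obtain ⟨-, M, hM⟩ := h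
  refine ⟨M, norm_le_of_norm_expSeries_le ha hf hφ fun k t ht => ?_⟩
  have h1 := hM ⟨k, t, ht, rfl⟩
  rwa [iteratedDerivWithin_zTransform_comp_exp ha hf k ht,
    div_le_iff₀ (weightedNorm_betaSeq_pos ha hφ k ht), weightedNorm_betaSeq] at h1

/-- A sequence is determined by its `Z`-transform. -/
theorem HasGrowth.eq_zero_of_expSeries_eq_zero [CompleteSpace X] {a : ℝ} (ha : 0 < a) {f : ℕ → X}
    (hf : HasGrowth a f) (h : ∀ t, Real.log a < t → expSeries f 0 t = 0) (m : ℕ) : f m = 0 := by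
  have hd : ∀ (k : ℕ) (t : ℝ), Real.log a < t → expSeries f k t = 0 := by
    intro k t ht
    have h1 : EqOn (expSeries f 0) (fun _ => 0) (Ioi (Real.log a)) := h
    rw [← iteratedDerivWithin_expSeries ha hf k ht, iteratedDerivWithin_congr h1 ht]
    simp
  -- The inversion bound needs no positive weight, so the zero sequence is admissible.
  have h0 : HasGrowth a fun _ : ℕ => (0 : ℝ) := fun y _ => ⟨0, by simp⟩
  simpa using norm_le_of_norm_expSeries_le ha hf h0 (M := 0)
    (fun k t ht => by simp [hd k t ht]) m

/-! ### Bounded maps on the weighted space -/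

/-- The map `g ↦ ∑ g(n) f(n)` on `ℓ¹_φ`. -/
noncomputable def sumMap [CompleteSpace X] {φ : ℕ → Ioi (0 : ℝ)} {f : ℕ → X} {M : ℝ}
    (h : ∀ n, ‖f n‖ ≤ M * φ n) : WeightedL1 φ →L[ℂ] X :=
  have hb : ∀ (g : WeightedL1 φ) n, ‖g.1 n • f n‖ ≤ M * ((φ n : ℝ) * ‖g.1 n‖) := fun g n => by
    rw [norm_smul]
    calc _ ≤ ‖g.1 n‖ * (M * φ n) := by gcongr; exact h n
      _ = _ := by ring
  have hs : ∀ g : WeightedL1 φ, Summable fun n => g.1 n • f n := fun g =>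
    Summable.of_norm_bounded (Summable.mul_left M g.2) (hb g)
  LinearMap.mkContinuous
    { toFun := fun g => ∑' n, g.1 n • f n
      map_add' := fun g g' => by
        rw [← (hs g).tsum_add (hs g')]
        exact tsum_congr fun n => add_smul _ _ _
      map_smul' := fun c g => by
        rw [RingHom.id_apply, ← (hs g).tsum_const_smul c]
        exact tsum_congr fun n => mul_smul _ _ _ }
    M fun g => tsum_of_norm_bounded (Summable.hasSum g.2 |>.mul_left M) (hb g)

theorem sumMap_apply [CompleteSpace X] {φ : ℕ → Ioi (0 : ℝ)} {f : ℕ → X} {M : ℝ}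
    (h : ∀ n, ‖f n‖ ≤ M * φ n) (g : WeightedL1 φ) : sumMap h g = ∑' n, g.1 n • f n := rfl

/-- The `n`-th unit sequence. -/
noncomputable def unitElem (φ : ℕ → Ioi (0 : ℝ)) (n : ℕ) : WeightedL1 φ :=
  ⟨Pi.single n 1, summable_of_ne_finset_zero (s := {n}) fun k hk => by
    rw [Pi.single_eq_of_ne (by simpa using hk)]; simp⟩

theorem norm_unitElem (φ : ℕ → Ioi (0 : ℝ)) (n : ℕ) : ‖unitElem φ n‖ = φ n := by
  change ∑' k, (φ k : ℝ) * ‖(Pi.single n (1 : ℂ) : ℕ → ℂ) k‖ = φ n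
  rw [tsum_eq_single n fun k hk => by rw [Pi.single_eq_of_ne hk]; simp]
  simp

theorem sum_smul_unitElem_apply {φ : ℕ → Ioi (0 : ℝ)} (c : ℕ → ℂ) (N k : ℕ) :
    (∑ n ∈ Finset.range N, c n • unitElem φ n).1 k = if k < N then c k else 0 := by
  induction N with
  | zero => rfl
  | succ N ih =>
    rw [Finset.sum_range_succ]
    change (∑ n ∈ Finset.range N, c n • unitElem φ n).1 k
      + c N * (Pi.single N (1 : ℂ) : ℕ → ℂ) k = _
    rw [ih]
    rcases lt_trichotomy k N with hk | rfl | hk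
    · simp [hk, hk.ne, hk.trans (Nat.lt_succ_self N)]
    · simp
    · simp [hk.ne', hk.not_gt, (Nat.succ_le_of_lt hk).not_gt]

/-- The error norm is a tail of the convergent series `∑ φ(n)|g(n)|`. -/
theorem tendsto_sum_smul_unitElem {φ : ℕ → Ioi (0 : ℝ)} (g : WeightedL1 φ) :
    Tendsto (fun N => ∑ n ∈ Finset.range N, g.1 n • unitElem φ n) atTop (𝓝 g) := by
  rw [tendsto_iff_norm_sub_tendsto_zero]
  have hg : Summable fun n => (φ n : ℝ) * ‖g.1 n‖ := g.2
  have h : ∀ N, ‖(∑ n ∈ Finset.range N, g.1 n • unitElem φ n) - g‖ =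
      ∑' k, if k < N then 0 else (φ k : ℝ) * ‖g.1 k‖ := fun N => by
    change ∑' k, (φ k : ℝ) * ‖(∑ n ∈ Finset.range N, g.1 n • unitElem φ n).1 k - g.1 k‖ = _
    refine tsum_congr fun k => ?_
    rw [sum_smul_unitElem_apply]
    split_ifs <;> simp
  simp only [h]
  have hz : (0 : ℝ) = ∑' _ : ℕ, (0 : ℝ) := tsum_zero.symm
  conv => enter [3]; rw [hz]
  refine tendsto_tsum_of_dominated_convergence hg (fun k => ?_) (Eventually.of_forall fun N k => ?_)
  · refine tendsto_const_nhds.congr' ?_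
    filter_upwards [eventually_gt_atTop k] with N hN
    simp [hN]
  · have h0 : (0 : ℝ) ≤ φ k * ‖g.1 k‖ := mul_nonneg (le_of_lt (φ k).2) (norm_nonneg _)
    split_ifs
    · simpa using h0
    · rw [Real.norm_of_nonneg h0]

theorem smul_pElem_apply {φ : ℕ → Ioi (0 : ℝ)} {C a : ℝ} (ha : 0 < a)
    (hφ : ∀ n, (φ n : ℝ) ≤ C * a ^ n) {x : ℝ} (hx : a < x) (n : ℕ) :
    ((x : ℂ) • pElem ha hφ hx : WeightedL1 φ).1 n = (x : ℂ) ^ (-(n : ℤ)) := by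
  have hx0 : (x : ℂ) ≠ 0 := by exact_mod_cast (ha.trans hx).ne'
  change (x : ℂ) * (x : ℂ) ^ (-((n : ℤ) + 1)) = _
  rw [← zpow_one_add₀ hx0]
  congr 1
  ring

/-- Uniqueness of the transform, applied to `f(n) - θ(e_n)`, identifies `f(n)` with `θ(e_n)`, which
the operator norm controls. -/
theorem norm_le_of_apply_pElem_eq [CompleteSpace X] {φ : ℕ → Ioi (0 : ℝ)} {C a : ℝ}
    (hC : 0 < C) (ha : 0 < a) (hφ : ∀ n, (φ n : ℝ) ≤ C * a ^ n) {f : ℕ → X}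
    (θ : WeightedL1 φ →L[ℂ] X) (hθ : ∀ (x : ℝ) (hx : a < x), ZConvergesAt f (x : ℂ) ∧
      θ ((x : ℂ) • pElem ha hφ hx) = zTransform f (x : ℂ)) (n : ℕ) : ‖f n‖ ≤ ‖θ‖ * φ n := by
  have hf : HasGrowth a f := hasGrowth_of_zConvergesAt ha fun x hx => (hθ x hx).1
  have hle : ∀ n, ‖θ (unitElem φ n)‖ ≤ ‖θ‖ * φ n := fun n => by
    simpa only [norm_unitElem] using θ.le_opNorm (unitElem φ n)
  have hh : HasGrowth a fun n => θ (unitElem φ n) :=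
    (hasGrowth_weight hC ha hφ).of_norm_le hle
  have hd : HasGrowth a fun n => f n - θ (unitElem φ n) := fun y hy => by
    obtain ⟨K, hK⟩ := hf y hy
    obtain ⟨L, hL⟩ := hh y hy
    exact ⟨K + L, fun n => (norm_sub_le _ _).trans (by rw [add_mul]; exact add_le_add (hK n) (hL n))⟩
  have h0 : ∀ t, Real.log a < t → expSeries (fun n => f n - θ (unitElem φ n)) 0 t = 0 := by
    intro t ht
    have hx : a < Real.exp t := (Real.log_lt_iff_lt_exp ha).1 ht
    -- Continuity lets `θ` pass through the expansion of `λp_λ`, giving the transform of `θ(e_n)`.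
    have h1 := (θ.continuous.tendsto _).comp
      (tendsto_sum_smul_unitElem (((Real.exp t : ℝ) : ℂ) • pElem ha hφ hx))
    have h2 := (hasSum_expSeries_zero ha hh ht).tendsto_sum_nat
    have h3 : θ (((Real.exp t : ℝ) : ℂ) • pElem ha hφ hx) =
        expSeries (fun n => θ (unitElem φ n)) 0 t := by
      refine tendsto_nhds_unique h1 (h2.congr fun N => ?_)
      simp only [Function.comp_apply, map_sum, map_smul, smul_pElem_apply]
    have h4 := (hθ _ hx).2
    rw [h3, hf.zTransform_exp ha ht] at h4
    have h5 := (hasSum_expSeries_zero ha hf ht).sub (hasSum_expSeries_zero ha hh ht)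
    simp only [← smul_sub] at h5
    rw [(hasSum_expSeries_zero ha hd ht).unique h5, h4, sub_self]
  rw [sub_eq_zero.1 (hd.eq_zero_of_expSeries_eq_zero ha h0 n)]
  exact hle n

end Transform

end ZWidder

theorem theorem4p1 {X : Type*} [NormedAddCommGroup X] [NormedSpace ℂ X] [CompleteSpace X]
    (φ : ℕ → Set.Ioi (0 : ℝ)) (C a : ℝ) (hC : 0 < C) (ha : 0 < a)
    (hφ : ∀ n, (φ n : ℝ) ≤ C * a ^ n) (f : ℕ → X) :
    List.TFAE [
      BddAbove (Set.range fun n : ℕ => ‖f n‖ / (φ n : ℝ)),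
      ∃ θ : ZWidder.WeightedL1 φ →L[ℂ] X, ∀ (x : ℝ) (hx : a < x),
        ZWidder.ZConvergesAt f (x : ℂ) ∧
          θ ((x : ℂ) • ZWidder.pElem ha hφ hx) = ZWidder.zTransform f (x : ℂ),
      (∀ x : ℝ, a < x → ZWidder.ZConvergesAt f (x : ℂ)) ∧
        ((fun x : ℝ => ZWidder.zTransform f (x : ℂ)) ∘ Real.exp) ∈
          ZWidder.WidderSpace (Real.log a) X φ] := by
  have hg := ZWidder.hasGrowth_weight hC ha hφ
  rw [ZWidder.bddAbove_range_norm_div_iff]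
  tfae_have 1 → 2
  | ⟨M, hM⟩ => by
    have hf := hg.of_norm_le hM
    refine ⟨ZWidder.sumMap hM, fun x hx => ⟨hf.zConvergesAt ha hx, ?_⟩⟩
    have hs := ZWidder.hasSum_expSeries_zero ha hf (Real.log_lt_log ha hx)
    have ht := hf.zTransform_exp ha (Real.log_lt_log ha hx)
    rw [Real.exp_log (ha.trans hx)] at hs ht
    simp only [ZWidder.sumMap_apply, ZWidder.smul_pElem_apply]
    rw [ht, hs.tsum_eq]
  tfae_have 2 → 1
  | ⟨θ, hθ⟩ => ⟨‖θ‖, ZWidder.norm_le_of_apply_pElem_eq hC ha hφ θ hθ⟩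
  tfae_have 1 → 3
  | ⟨M, hM⟩ => ⟨fun _ hx => (hg.of_norm_le hM).zConvergesAt ha hx,
      ZWidder.HasGrowth.comp_exp_mem_widderSpace ha hg hM⟩
  tfae_have 3 → 1
  | ⟨hc, hw⟩ => ZWidder.norm_le_of_mem_widderSpace ha hg
      (ZWidder.hasGrowth_of_zConvergesAt ha hc) hw
  tfae_finish
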